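/- For a group $G$ let $C^*(G)$ be the full group C*-algebra, i.e. the completion of the group $*$-algebra $\mathbb C[G]$ in its largest C*-seminorm. An operator system $X$ in a unital C*-algebra $B$ is a self-adjoint linear subspace containing $1_B$; for $k\ge 1$, $M_k(X)\subseteq M_k(B)$ carries the norm and order of $M_k(B)$, and for a linear map $\phi:X\to A$ into a C*-algebra $\|\phi\|_k\in[0,\infty]$ denotes the norm of $[x_{ij}]\mapsto[\phi(x_{ij})]$, $M_k(X)\to M_k(A)$. A u.c.p. map is a unital map all of whose amplifications $M_k(X)\to M_k(A)$ are positive. The operator system $X$ is called CP-stable if for every finite-dimensional operator subsystem $E\subseteq X$ and every $\delta>0$ there are a finite-dimensional operator subsystem $S$ with $E\subseteq S\subseteq X$, an integer $k\ge1$ and $\epsilon>0$ such that for every unital C*-algebra $A$ and every unital linear map $\phi:S\to A$ with $\|\phi\|_k<1+\epsilon$ there is a u.c.p. map $\psi:E\to A$ with $\|\phi|_E-\psi\|<\delta$. Theorem. Let $n\ge 0$, let $u_1,\dots,u_n$ be the canonical unitary generators of $C^*(\mathbb F_n)$, put $u_{n+1}:=1$, and let $W_n$ be the operator system spanned by $\{u_i^*u_j:1\le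 i,j\le n+1\}$. Then $W_n$ is CP-stable. Moreover, for every $\delta>0$ there is $\epsilon>0$ (depending only on $n$ and $\delta$) such that for every unital C*-algebra $A$ and every unital linear map $\phi:W_n\to A$ with $\|\phi\|_{n+1}<1+\epsilon$ there is a u.c.p. map $\psi:W_n\to A$ with $\|\psi-\phi\|<\delta$. -/

import Mathlib

universe u v

noncomputable section

/-! ### The full group C*-algebra

`C*(G)` is the completion of the group `*`-algebra `ℂ[G]` with respect to its largest
C*-seminorm. -/

/-- The complex group algebra `ℂ[G]` (a type synonym, carrying its standard involution and its
largest C*-seminorm). -/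
def GroupStarAlg (G : Type u) [Group G] : Type u := MonoidAlgebra ℂ G

namespace GroupStarAlg

variable {G : Type u} [Group G]

instance : Ring (GroupStarAlg G) := inferInstanceAs (Ring (MonoidAlgebra ℂ G))

instance : Algebra ℂ (GroupStarAlg G) := inferInstanceAs (Algebra ℂ (MonoidAlgebra ℂ G))

/-- The element `c • g` of the group algebra. -/
def single (g : G) (c : ℂ) : GroupStarAlg G := MonoidAlgebra.single g c

/-- The coefficients of an element of the group algebra. -/
def coeff (x : GroupStarAlg G) : G →₀ ℂ := MonoidAlgebra.coeff x

theorem coeff_injective : Function.Injective (coeff : GroupStarAlg G → G →₀ ℂ) :=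
  MonoidAlgebra.coeff_injective

theorem coeff_single (g : G) (c : ℂ) : coeff (single g c) = Finsupp.single g c := rfl

theorem single_mul_single (g h : G) (c d : ℂ) :
    single g c * single h d = single (g * h) (c * d) :=
  MonoidAlgebra.single_mul_single g h c d

theorem smul_single (c : ℂ) (g : G) (d : ℂ) : c • single g d = single g (c * d) :=
  MonoidAlgebra.smul_single c g d

theorem one_def : (1 : GroupStarAlg G) = single 1 1 := rfl

theorem induction_linear {P : GroupStarAlg G → Prop} (x : GroupStarAlg G) (zero : P 0)
    (add : ∀ x y, P x → P y → P (x + y)) (single : ∀ g c, P (single g c)) : P x :=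
  MonoidAlgebra.induction_linear (motive := P) x zero add single

/-- The involution `(∑ c_g g)^* = ∑ conj(c_g) g⁻¹`. -/
instance : Star (GroupStarAlg G) where
  star x := MonoidAlgebra.ofCoeff
    (Finsupp.mapRange star (star_zero ℂ)
      (Finsupp.equivMapDomain (Equiv.inv G) x.coeff))

theorem star_apply (x : GroupStarAlg G) (g : G) :
    (star x).coeff g = star (x.coeff g⁻¹) := rfl

theorem star_add' (x y : GroupStarAlg G) : star (x + y) = star x + star y := by
  apply coeff_injective
  ext g
  exact star_add (x.coeff g⁻¹) (y.coeff g⁻¹)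

theorem star_single (g : G) (c : ℂ) : star (single g c) = single g⁻¹ (star c) := by
  apply coeff_injective
  ext h
  rw [star_apply]
  classical
  rw [coeff_single, coeff_single, Finsupp.single_apply, Finsupp.single_apply]
  by_cases h1 : g = h⁻¹
  · rw [if_pos h1, if_pos (by rw [h1, inv_inv])]
  · rw [if_neg h1, if_neg (fun e => h1 (by rw [← e, inv_inv])), star_zero]

theorem star_zero' : star (0 : GroupStarAlg G) = 0 := by
  apply coeff_injective
  ext g
  exact star_zero ℂ

instance : StarRing (GroupStarAlg G) where
  star_involutive x := by
    apply coeff_injective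
    ext g
    simp [star_apply]
  star_add := star_add'
  star_mul x y := by
    induction x using induction_linear with
    | zero => simp [star_zero']
    | add a b ha hb => rw [add_mul, star_add', ha, hb, star_add', mul_add]
    | single g c =>
      induction y using induction_linear with
      | zero => simp [star_zero']
      | add a b ha hb => rw [mul_add, star_add', ha, hb, star_add', add_mul]
      | single h d =>
        rw [single_mul_single, star_single, star_single, star_single, single_mul_single,
          mul_inv_rev, star_mul]

instance : StarModule ℂ (GroupStarAlg G) where
  star_smul c x := by
    induction x using induction_linear with
    | zero => simp
    | add a b ha hb => rw [smul_add, star_add, ha, hb, star_add, smul_add]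
    | single g d =>
      rw [smul_single, star_single, star_single, smul_single, star_mul, mul_comm]

/-- A C*-seminorm on `ℂ[G]`: a submultiplicative seminorm satisfying the C*-identity. These are
exactly the seminorms `x ↦ ‖π x‖`, `π` a `*`-homomorphism from `ℂ[G]` to a C*-algebra. -/
structure IsCStarSeminorm (p : Seminorm ℂ (GroupStarAlg G)) : Prop where
  mul_le : ∀ x y, p (x * y) ≤ p x * p y
  star_mul_self : ∀ x, p (star x * x) = p x * p x

theorem isCStarSeminorm_zero : IsCStarSeminorm (0 : Seminorm ℂ (GroupStarAlg G)) where
  mul_le _ _ := by simp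
  star_mul_self _ := by simp

variable (G) in
/-- The type of all C*-seminorms on `ℂ[G]`. -/
abbrev CStarSeminorm : Type u := {p : Seminorm ℂ (GroupStarAlg G) // IsCStarSeminorm p}

instance : Nonempty (CStarSeminorm G) := ⟨⟨0, isCStarSeminorm_zero⟩⟩

theorem IsCStarSeminorm.single_le {p : Seminorm ℂ (GroupStarAlg G)} (hp : IsCStarSeminorm p)
    (g : G) (c : ℂ) : p (single g c) ≤ ‖c‖ := by
  have h1 : p 1 ≤ 1 := by
    have h := hp.star_mul_self 1
    rw [star_one, mul_one] at h
    nlinarith [apply_nonneg p 1, sq_nonneg (p 1 - 1)]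
  have h2 : p (single g 1) ≤ 1 := by
    have h := hp.star_mul_self (single g 1)
    rw [star_single, single_mul_single, inv_mul_cancel, star_one, mul_one, ← one_def] at h
    nlinarith [apply_nonneg p (single g 1)]
  have h3 : single g c = c • single g 1 := by rw [smul_single, mul_one]
  rw [h3, map_smul_eq_mul]
  exact mul_le_of_le_one_right (norm_nonneg c) h2

theorem bddAbove (x : GroupStarAlg G) :
    BddAbove (Set.range fun p : CStarSeminorm G => p.1 x) := by
  induction x using induction_linear with
  | zero => exact ⟨0, by rintro _ ⟨p, rfl⟩; simp⟩
  | add a b ha hb =>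
    obtain ⟨A, hA⟩ := ha
    obtain ⟨B, hB⟩ := hb
    refine ⟨A + B, ?_⟩
    rintro _ ⟨p, rfl⟩
    exact (map_add_le_add p.1 a b).trans (add_le_add (hA ⟨p, rfl⟩) (hB ⟨p, rfl⟩))
  | single g c => exact ⟨‖c‖, by rintro _ ⟨p, rfl⟩; exact p.2.single_le g c⟩

/-- The value at `x` of the largest C*-seminorm on `ℂ[G]`. -/
def maxNorm (x : GroupStarAlg G) : ℝ := ⨆ p : CStarSeminorm G, p.1 x

theorem le_maxNorm (p : CStarSeminorm G) (x : GroupStarAlg G) : p.1 x ≤ maxNorm x :=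
  le_ciSup (bddAbove x) p

theorem maxNorm_nonneg (x : GroupStarAlg G) : 0 ≤ maxNorm x :=
  Real.iSup_nonneg fun p => apply_nonneg p.1 x

variable (G) in
/-- The largest C*-seminorm on `ℂ[G]`, as a seminorm. -/
def maxSeminorm : Seminorm ℂ (GroupStarAlg G) :=
  Seminorm.of maxNorm
    (fun x y => ciSup_le fun p => (map_add_le_add p.1 x y).trans
      (add_le_add (le_maxNorm p x) (le_maxNorm p y)))
    (fun c x => by
      simp only [maxNorm, map_smul_eq_mul]
      exact (Real.mul_iSup_of_nonneg (norm_nonneg c) _).symm)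

theorem maxSeminorm_isCStar : IsCStarSeminorm (maxSeminorm G) where
  mul_le x y := ciSup_le fun p => (p.2.mul_le x y).trans
    (mul_le_mul (le_maxNorm p x) (le_maxNorm p y) (apply_nonneg p.1 y) (maxNorm_nonneg x))
  star_mul_self x := by
    change maxNorm _ = maxNorm x * maxNorm x
    apply le_antisymm
    · refine ciSup_le fun p => ?_
      rw [p.2.star_mul_self]
      exact mul_le_mul (le_maxNorm p x) (le_maxNorm p x) (apply_nonneg p.1 x) (maxNorm_nonneg x)
    · have h : maxNorm x ≤ Real.sqrt (maxNorm (star x * x)) := by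
        refine ciSup_le fun p => Real.le_sqrt_of_sq_le ?_
        rw [sq, ← p.2.star_mul_self]
        exact le_maxNorm p _
      calc maxNorm x * maxNorm x
          ≤ Real.sqrt (maxNorm (star x * x)) * Real.sqrt (maxNorm (star x * x)) :=
            mul_self_le_mul_self (maxNorm_nonneg x) h
        _ = _ := Real.mul_self_sqrt (maxNorm_nonneg _)

instance : SeminormedRing (GroupStarAlg G) where
  __ := (maxSeminorm G).toAddGroupSeminorm.toSeminormedAddCommGroup
  __ := (inferInstance : Ring (GroupStarAlg G))
  norm_mul_le := maxSeminorm_isCStar.mul_le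

theorem norm_def (x : GroupStarAlg G) : ‖x‖ = maxNorm x := rfl

theorem norm_star_mul_self' (x : GroupStarAlg G) : ‖star x * x‖ = ‖x‖ * ‖x‖ :=
  maxSeminorm_isCStar.star_mul_self x

instance : NormedSpace ℂ (GroupStarAlg G) where
  norm_smul_le c x := (map_smul_eq_mul (maxSeminorm G) c x).le

theorem norm_star_le (x : GroupStarAlg G) : ‖star x‖ ≤ ‖x‖ := by
  have h := norm_star_mul_self' (star x)
  rw [star_star] at h
  have h2 := norm_mul_le x (star x)
  rw [h] at h2
  rcases (norm_nonneg (star x)).eq_or_lt with h0 | h0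
  · rw [← h0]; exact norm_nonneg x
  · exact le_of_mul_le_mul_right h2 h0

instance : NormedStarGroup (GroupStarAlg G) where
  norm_star_le := norm_star_le

end GroupStarAlg

/-- The full group C*-algebra `C*(G)`: the (Hausdorff) completion of `ℂ[G]` for its largest
C*-seminorm. -/
def FullGroupCStarAlgebra (G : Type u) [Group G] : Type u :=
  UniformSpace.Completion (GroupStarAlg G)

namespace FullGroupCStarAlgebra

open UniformSpace

variable {G : Type u} [Group G]

instance : NormedRing (FullGroupCStarAlgebra G) :=
  inferInstanceAs (NormedRing (Completion (GroupStarAlg G)))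

instance : CompleteSpace (FullGroupCStarAlgebra G) :=
  inferInstanceAs (CompleteSpace (Completion (GroupStarAlg G)))

instance : Algebra ℂ (FullGroupCStarAlgebra G) :=
  inferInstanceAs (Algebra ℂ (Completion (GroupStarAlg G)))

instance : NormedAlgebra ℂ (FullGroupCStarAlgebra G) where
  norm_smul_le := norm_smul_le (α := ℂ) (β := Completion (GroupStarAlg G))

/-- The canonical map `ℂ[G] → C*(G)`. -/
def coe (x : GroupStarAlg G) : FullGroupCStarAlgebra G := (x : Completion (GroupStarAlg G))

/-- The involution of `C*(G)`: the continuous extension of that of `ℂ[G]`. -/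
instance : Star (FullGroupCStarAlgebra G) where
  star := Completion.map (star : GroupStarAlg G → GroupStarAlg G)

theorem continuous_star' : Continuous (star : FullGroupCStarAlgebra G → FullGroupCStarAlgebra G) :=
  Completion.continuous_map

theorem uniformContinuous_star' : UniformContinuous (star : GroupStarAlg G → GroupStarAlg G) :=
  (starₗᵢ ℂ : GroupStarAlg G ≃ₗᵢ⋆[ℂ] GroupStarAlg G).isometry.uniformContinuous

theorem star_coe (x : GroupStarAlg G) : star (coe x) = coe (star x) :=
  Completion.map_coe uniformContinuous_star' x

theorem coe_add (x y : GroupStarAlg G) : coe (x + y) = coe x + coe y := Completion.coe_add x y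

theorem coe_mul (x y : GroupStarAlg G) : coe (x * y) = coe x * coe y := Completion.coe_mul x y

theorem coe_smul (c : ℂ) (x : GroupStarAlg G) : coe (c • x) = c • coe x :=
  Completion.coe_smul c x

theorem norm_coe (x : GroupStarAlg G) : ‖coe x‖ = ‖x‖ := Completion.norm_coe x

theorem induction_on {P : FullGroupCStarAlgebra G → Prop} (x : FullGroupCStarAlgebra G)
    (hP : IsClosed {x | P x}) (h : ∀ x, P (coe x)) : P x :=
  Completion.induction_on (p := P) x hP h

instance : StarRing (FullGroupCStarAlgebra G) where
  star_involutive x := by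
    induction x using induction_on with
    | hP => exact isClosed_eq (continuous_star'.comp continuous_star') continuous_id
    | h x => rw [star_coe, star_coe, star_star]
  star_mul x y := by
    induction x using induction_on with
    | hP =>
      exact isClosed_eq (continuous_star'.comp (continuous_id.mul continuous_const))
        (continuous_const.mul continuous_star')
    | h x =>
      induction y using induction_on with
      | hP =>
        exact isClosed_eq (continuous_star'.comp (continuous_const.mul continuous_id))
          (continuous_star'.mul continuous_const)
      | h y => rw [← coe_mul, star_coe, star_coe, star_coe, star_mul, coe_mul]
  star_add x y := by
    induction x using induction_on with
    | hP =>
      exact isClosed_eq (continuous_star'.comp (continuous_id.add continuous_const))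
        (continuous_star'.add continuous_const)
    | h x =>
      induction y using induction_on with
      | hP =>
        exact isClosed_eq (continuous_star'.comp (continuous_const.add continuous_id))
          (continuous_const.add continuous_star')
      | h y => rw [← coe_add, star_coe, star_coe, star_coe, star_add, coe_add]

instance : StarModule ℂ (FullGroupCStarAlgebra G) where
  star_smul c x := by
    induction x using induction_on with
    | hP =>
      exact isClosed_eq (continuous_star'.comp (continuous_const_smul c))
        ((continuous_const_smul (star c)).comp continuous_star')
    | h x => rw [← coe_smul, star_coe, star_coe, star_smul, coe_smul]

instance : CStarRing (FullGroupCStarAlgebra G) where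
  norm_mul_self_le x := by
    induction x using induction_on with
    | hP =>
      exact isClosed_le (continuous_norm.mul continuous_norm)
        (continuous_norm.comp (continuous_star'.mul continuous_id))
    | h x =>
      rw [star_coe, ← coe_mul, norm_coe, norm_coe, GroupStarAlg.norm_star_mul_self']

instance : CStarAlgebra (FullGroupCStarAlgebra G) where

/-- The order of `C*(G)` as a C*-algebra. -/
instance : PartialOrder (FullGroupCStarAlgebra G) := CStarAlgebra.spectralOrder _

instance : StarOrderedRing (FullGroupCStarAlgebra G) := CStarAlgebra.spectralOrderedRing _

/-- The canonical unitary of `C*(G)` attached to `g : G`. -/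
def of (g : G) : FullGroupCStarAlgebra G := coe (GroupStarAlg.single g 1)

end FullGroupCStarAlgebra

/-! ### Operator systems, matrix norms and completely positive maps -/

/-- An operator system in the unital C*-algebra `B`: a self-adjoint linear subspace containing the
unit. Its matrix norms and matrix orders are those inherited from the algebras `M_k(B)`. -/
structure OperatorSystem (B : Type u) [CStarAlgebra B] extends Submodule ℂ B where
  one_mem' : (1 : B) ∈ carrier
  star_mem' : ∀ {x : B}, x ∈ carrier → star x ∈ carrier

/-- The operator norm of a linear map between normed spaces, with value `∞` if it is unbounded. -/
def opENorm {E : Type u} {F : Type v} [NormedAddCommGroup E] [NormedSpace ℂ E]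
    [NormedAddCommGroup F] [NormedSpace ℂ F] (f : E →ₗ[ℂ] F) : ENNReal :=
  ⨆ (x : E) (_ : ‖x‖ ≤ 1), ENNReal.ofReal ‖f x‖

namespace OperatorSystem

variable {B : Type u} [CStarAlgebra B] [PartialOrder B] [StarOrderedRing B]
  {A : Type v} [CStarAlgebra A] [PartialOrder A] [StarOrderedRing A] {X : OperatorSystem B}

/-- `φ(1) = 1`. -/
def IsUnital (φ : X.toSubmodule →ₗ[ℂ] A) : Prop := φ ⟨1, X.one_mem'⟩ = 1

/-- `‖φ‖_k`: the norm of the amplification `[x_{ij}] ↦ [φ(x_{ij})]` from `M_k(X) ⊆ M_k(B)` to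
`M_k(A)`, both with their C*-norms (with value `∞` if it is unbounded). -/
def matrixENorm (k : ℕ) (φ : X.toSubmodule →ₗ[ℂ] A) : ENNReal :=
  ⨆ (M : CStarMatrix (Fin k) (Fin k) X.toSubmodule)
    (_ : ‖(M.map (fun x => (x : B)) : CStarMatrix (Fin k) (Fin k) B)‖ ≤ 1),
    ENNReal.ofReal ‖(M.map φ : CStarMatrix (Fin k) (Fin k) A)‖

/-- `φ` is completely positive: for every `k` its amplification maps matrices over `X` that are
positive in `M_k(B)` to positive elements of `M_k(A)`. -/
def IsCompletelyPositive (φ : X.toSubmodule →ₗ[ℂ] A) : Prop :=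
  ∀ (k : ℕ) (M : CStarMatrix (Fin k) (Fin k) X.toSubmodule),
    0 ≤ (M.map (fun x => (x : B)) : CStarMatrix (Fin k) (Fin k) B) →
      0 ≤ (M.map φ : CStarMatrix (Fin k) (Fin k) A)

/-- Unital completely positive maps. -/
def IsUCP (φ : X.toSubmodule →ₗ[ℂ] A) : Prop := IsUnital φ ∧ IsCompletelyPositive φ

/-- `X` is CP-stable: for every finite-dimensional subsystem `E ⊆ X` and `δ > 0` there are a
finite-dimensional subsystem `E ⊆ S ⊆ X`, an integer `k > 0` and `ε > 0` such that for every unital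
C*-algebra `A` and every unital linear map `φ : S → A` with `‖φ‖_k < 1 + ε` there is a u.c.p. map
`ψ : E → A` with `‖φ|_E - ψ‖ < δ`. -/
def CPStable {B : Type u} [CStarAlgebra B] [PartialOrder B] [StarOrderedRing B]
    (X : OperatorSystem B) : Prop :=
  ∀ E : OperatorSystem B, E.toSubmodule ≤ X.toSubmodule → FiniteDimensional ℂ E.toSubmodule →
    ∀ δ : ℝ, 0 < δ →
      ∃ (S : OperatorSystem B) (hES : E.toSubmodule ≤ S.toSubmodule),
        S.toSubmodule ≤ X.toSubmodule ∧ FiniteDimensional ℂ S.toSubmodule ∧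
        ∃ (k : ℕ) (ε : ℝ), 0 < k ∧ 0 < ε ∧
          ∀ (A : Type v) [CStarAlgebra A] [PartialOrder A] [StarOrderedRing A]
            (φ : S.toSubmodule →ₗ[ℂ] A), IsUnital φ →
              matrixENorm k φ < ENNReal.ofReal (1 + ε) →
                ∃ ψ : E.toSubmodule →ₗ[ℂ] A, IsUCP ψ ∧
                  opENorm (φ ∘ₗ Submodule.inclusion hES - ψ) < ENNReal.ofReal δ

end OperatorSystem

/-! ### The operator systems `W_n` -/

/-- `u_1, …, u_n, u_{n+1}` in `C*(F_n)`: the canonical unitary generators, followed by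
`u_{n+1} = 1`. -/
def freeUnitary (n : ℕ) : Fin (n + 1) → FullGroupCStarAlgebra (FreeGroup (Fin n)) :=
  Fin.lastCases 1 fun i => FullGroupCStarAlgebra.of (FreeGroup.of i)

/-- `W_n ⊆ C*(F_n)`, the span of all `u_i^* u_j`, `1 ≤ i, j ≤ n + 1`. -/
def freeOperatorSystem (n : ℕ) : OperatorSystem (FullGroupCStarAlgebra (FreeGroup (Fin n))) where
  toSubmodule := Submodule.span ℂ
    (Set.range fun ij : Fin (n + 1) × Fin (n + 1) =>
      star (freeUnitary n ij.1) * freeUnitary n ij.2)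
  one_mem' := Submodule.subset_span ⟨(Fin.last n, Fin.last n), by simp [freeUnitary]⟩
  star_mem' := by
    intro x hx
    change star x ∈ Submodule.span ℂ _
    change x ∈ Submodule.span ℂ _ at hx
    induction hx using Submodule.span_induction with
    | mem x h =>
      obtain ⟨⟨i, j⟩, rfl⟩ := h
      exact Submodule.subset_span ⟨(j, i), by simp⟩
    | zero => simp
    | add x y _ _ hx hy => rw [star_add]; exact Submodule.add_mem _ hx hy
    | smul c x _ hx => rw [star_smul]; exact Submodule.smul_mem _ _ hx

end

/-!
The matrix `[u_i^* u_j]` generates `W_n`, and it is universal in the following sense: for *every*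
positive matrix `P ∈ M_{n+1}(A)` with unit diagonal there is a u.c.p. map `ψ : W_n → A` with
`ψ(u_i^* u_j) = P_{ij}` (`exists_isUCP_of_nonneg`). So it is enough to show that a unital map `φ`
which is almost contractive on `M_{n+1}(W_n)` sends `[u_i^* u_j]` close to such a matrix.

*Existence of `ψ`.* Write `P = S^* S` with `S ∈ M_{n+1}(A)`. The columns of `S`, each placed in one
fixed column of a square matrix, are partial isometries `s_j` with a common initial projection `e`.
Their Halmos dilations `U_j` are unitaries over `M_{n+1}(A)`, and the `e`-corner of `U_i^* U_j` is
`s_i^* s_j`, whose only entry is `P_{ij}` (`exists_unitary_dilation`). The universal property of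
`C*(F_n)` gives a `*`-homomorphism `u_j ↦ U_{n+1}^* U_j`, and compressing it to a diagonal entry
gives `ψ`. The compression is completely positive by `CStarMatrix.nonneg_map_diagEntry`.
No representation of `A` on a Hilbert space is needed.

*Almost positivity.* Put `N = n + 1`. As `[u_i^* u_j] / N` is a projection,
`V = (2 / N) [u_i^* u_j] - 1` is a self-adjoint unitary and `‖V + i t‖ ≤ √(1 + t²)` for all real
`t`. If `‖φ‖_N < 1 + s²`, the image `Y` of `V` satisfies `‖Y + i t‖ ≤ (1 + s²) √(1 + t²)`. With
`t = 0` this gives `-(1 + s²) ≤ ℜ Y`, and with `t = ±1/s` it gives `‖ℑ Y‖ ≤ 4 s`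
(`norm_imaginaryPart_le`). Adding a small multiple of `1` to the real part of `[φ(u_i^* u_j)]` and
rescaling yields a positive matrix with unit diagonal at distance `O(s)`
(`nonneg_and_norm_sub_le`).

*Norm estimate.* `W_n` is finite-dimensional, so every element is a combination of the
`u_i^* u_j` with coefficients bounded by a multiple of its norm, and closeness on the generators is
closeness in norm (`exists_norm_le_of_forall_generator`). For CP-stability one takes `S = W_n` and
`k = n + 1` for every `E`, and restricts `ψ` to `E`.
-/

noncomputable section

/-! ### The universal property of the full group C*-algebra -/

namespace GroupStarAlg

variable {G : Type u} [Group G] {D : Type v} [CStarAlgebra D]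

/-- The `*`-homomorphism `ℂ[G] → D` extending a group homomorphism from `G` to the unitary group
of `D`. -/
def lift (f : G →* unitary D) : GroupStarAlg G →⋆ₐ[ℂ] D :=
  let F : GroupStarAlg G →ₐ[ℂ] D := MonoidAlgebra.lift ℂ D G ((unitary D).subtype.comp f)
  have hF (g : G) (c : ℂ) : F (single g c) = c • (f g : D) :=
    MonoidAlgebra.lift_single ((unitary D).subtype.comp f) g c
  { F with
    map_star' x := by
      change F (star x) = star (F x)
      induction x using induction_linear with
      | zero => simp
      | add a b ha hb => rw [star_add, map_add, ha, hb, map_add, star_add]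
      | single g c =>
        rw [star_single, hF, hF, map_inv, star_smul]
        rfl }

theorem lift_single (f : G →* unitary D) (g : G) (c : ℂ) :
    lift f (single g c) = c • (f g : D) :=
  MonoidAlgebra.lift_single ((unitary D).subtype.comp f) g c

theorem norm_lift_le (f : G →* unitary D) (x : GroupStarAlg G) : ‖lift f x‖ ≤ ‖x‖ := by
  let p : Seminorm ℂ (GroupStarAlg G) :=
    (normSeminorm ℂ D).comp (lift f : GroupStarAlg G →ₗ[ℂ] D)
  have hp (y : GroupStarAlg G) : p y = ‖lift f y‖ := rfl
  refine le_maxNorm ⟨p, ⟨fun x y => ?_, fun x => ?_⟩⟩ x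
  · rw [hp, hp, hp, map_mul]
    exact norm_mul_le _ _
  · rw [hp, hp, map_mul, map_star, CStarRing.norm_star_mul_self]

end GroupStarAlg

namespace FullGroupCStarAlgebra

variable {G : Type u} [Group G] {D : Type v} [CStarAlgebra D]

/-- The universal property of `C*(G)`: every group homomorphism from `G` to the unitary group of a
C*-algebra `D` extends to a `*`-homomorphism `C*(G) → D`. -/
theorem exists_starAlgHom (f : G →* unitary D) :
    ∃ π : FullGroupCStarAlgebra G →⋆ₐ[ℂ] D, ∀ g, π (of g) = f g := by
  have hc : Continuous (GroupStarAlg.lift f) :=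
    AddMonoidHomClass.continuous_of_bound (GroupStarAlg.lift f) 1 fun x => by
      rw [one_mul]
      exact GroupStarAlg.norm_lift_le f x
  let F : FullGroupCStarAlgebra G →+* D :=
    UniformSpace.Completion.extensionHom (GroupStarAlg.lift f : GroupStarAlg G →+* D) hc
  have hFc : Continuous F := UniformSpace.Completion.continuous_extension
  have hF (x : GroupStarAlg G) : F (coe x) = GroupStarAlg.lift f x :=
    UniformSpace.Completion.extensionHom_coe (GroupStarAlg.lift f : GroupStarAlg G →+* D) hc x
  let π : FullGroupCStarAlgebra G →⋆ₐ[ℂ] D :=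
    { F with
      commutes' c := by
        change F (coe (algebraMap ℂ (GroupStarAlg G) c)) = _
        rw [hF]
        exact AlgHomClass.commutes (GroupStarAlg.lift f) c
      map_star' x := by
        change F (star x) = star (F x)
        induction x using induction_on with
        | hP => exact isClosed_eq (hFc.comp continuous_star') (continuous_star.comp hFc)
        | h x => rw [star_coe, hF, hF, map_star] }
  refine ⟨π, fun g => ?_⟩
  change F (coe _) = _
  rw [hF, GroupStarAlg.lift_single, one_smul]

theorem of_mem_unitary (g : G) : of g ∈ unitary (FullGroupCStarAlgebra G) := by
  rw [Unitary.mem_iff, of, star_coe, ← coe_mul, ← coe_mul, GroupStarAlg.star_single,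
    GroupStarAlg.single_mul_single, GroupStarAlg.single_mul_single, inv_mul_cancel,
    mul_inv_cancel, star_one, mul_one]
  exact ⟨rfl, rfl⟩

end FullGroupCStarAlgebra

/-! ### Compressions and unitary dilations -/

/-- Stated for an abstract C*-algebra because instance search does not find the functional calculus
on `CStarMatrix` directly. -/
theorem CStarAlgebra.exists_eq_star_mul_self {C : Type*} [CStarAlgebra C] [PartialOrder C]
    [StarOrderedRing C] {a : C} (ha : 0 ≤ a) : ∃ y, a = star y * y :=
  CStarAlgebra.nonneg_iff_eq_star_mul_self.mp ha

namespace CStarMatrix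

variable {A : Type v} [CStarAlgebra A] {m : Type*} [DecidableEq m]

/-- Passing to a diagonal entry is a completely positive map `M_m(A) → A`. On a positive
matrix `Y^* Y` over `M_m(A)` it is `∑ q, R_q^* R_q`, where `R_q` collects the `(q, p)` entries
of `Y`. -/
theorem nonneg_map_diagEntry [PartialOrder A] [StarOrderedRing A] [Fintype m]
    {k : Type*} [Fintype k] [DecidableEq k] (p : m)
    {M : CStarMatrix k k (CStarMatrix m m A)} (hM : 0 ≤ M) :
    0 ≤ (M.map fun d => d p p : CStarMatrix k k A) := by
  obtain ⟨Y, rfl⟩ := CStarAlgebra.exists_eq_star_mul_self hM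
  have h : ((star Y * Y).map fun d => d p p : CStarMatrix k k A) =
      ∑ q, star (Y.map fun d => d q p : CStarMatrix k k A) * Y.map fun d => d q p := by
    ext i j
    have hs : (∑ q, star (Y.map fun d => d q p : CStarMatrix k k A) * Y.map fun d => d q p) i j
        = ∑ q, (star (Y.map fun d => d q p : CStarMatrix k k A) * Y.map fun d => d q p) i j :=
      Matrix.sum_apply i j _ _
    have hs' (g : k → CStarMatrix m m A) : (∑ l, g l) p p = ∑ l, (g l) p p :=
      Matrix.sum_apply p p _ _
    rw [hs, map_apply, mul_apply, hs']
    simp only [mul_apply, star_apply, map_apply]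
    exact Finset.sum_comm
  rw [h]
  exact Finset.sum_nonneg fun q _ => star_mul_self_nonneg _

/-- The square matrix whose column `p` is the column `j` of `S` and whose other columns vanish. -/
def columnAt (p : m) (S : CStarMatrix m m A) (j : m) : CStarMatrix m m A :=
  ofMatrix fun a b => if b = p then S a j else 0

theorem columnAt_apply (p : m) (S : CStarMatrix m m A) (j a b : m) :
    columnAt p S j a b = if b = p then S a j else 0 := rfl

theorem star_columnAt_mul_columnAt_apply [Fintype m] (p : m) (S : CStarMatrix m m A) (i j a b : m) :
    (star (columnAt p S i) * columnAt p S j) a b =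
      if a = p ∧ b = p then (star S * S) i j else 0 := by
  simp only [mul_apply, star_apply, columnAt_apply]
  by_cases ha : a = p <;> by_cases hb : b = p <;> simp [ha, hb]

end CStarMatrix

/-- The Halmos matrix with rows `(s, 1 - s s^*)` and `(1 - s^* s, s^*)`. It is unitary for a partial
isometry `s`, the case in which no square roots of the defects are needed. -/
def halmosMatrix {C : Type*} [Ring C] [StarRing C] (s : C) : CStarMatrix (Fin 2) (Fin 2) C :=
  CStarMatrix.ofMatrix !![s, 1 - s * star s; 1 - star s * s, star s]

theorem halmosMatrix_mem_unitary {C : Type*} [Ring C] [StarRing C] {s : C}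
    (hs : s * star s * s = s) : halmosMatrix s ∈ unitary (CStarMatrix (Fin 2) (Fin 2) C) := by
  have hs' : star s * s * star s = star s := by
    simpa [mul_assoc] using congrArg star hs
  rw [Unitary.mem_iff]
  constructor
  · ext i j
    fin_cases i <;> fin_cases j <;>
      simp [halmosMatrix, CStarMatrix.mul_apply, CStarMatrix.star_apply, mul_sub, sub_mul,
        ← mul_assoc, hs, hs']
  · ext i j
    fin_cases i <;> fin_cases j <;>
      simp [halmosMatrix, CStarMatrix.mul_apply, CStarMatrix.star_apply, mul_sub, sub_mul,
        ← mul_assoc, hs, hs']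

theorem star_halmosMatrix_mul_halmosMatrix_apply_zero {C : Type*} [Ring C] [StarRing C] (s t : C) :
    (star (halmosMatrix s) * halmosMatrix t) 0 0 =
      star s * t + (1 - star s * s) * (1 - star t * t) := by
  simp [halmosMatrix, CStarMatrix.mul_apply, CStarMatrix.star_apply]

/-- A positive matrix `P` over `A` with unit diagonal is `[U_i^* U_j]` compressed to one corner, for
unitaries `U_i` over `A`. -/
theorem exists_unitary_dilation {A : Type v} [CStarAlgebra A] [PartialOrder A] [StarOrderedRing A]
    {m : Type*} [Fintype m] [DecidableEq m] (p : m) {P : CStarMatrix m m A} (hP : 0 ≤ P)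
    (hdiag : ∀ i, P i i = 1) :
    ∃ U : m → unitary (CStarMatrix (Fin 2) (Fin 2) (CStarMatrix m m A)),
      ∀ i j, (star (U i : CStarMatrix (Fin 2) (Fin 2) (CStarMatrix m m A)) * U j) 0 0 p p
        = P i j := by
  obtain ⟨S, rfl⟩ := CStarAlgebra.exists_eq_star_mul_self hP
  have hmul (i j a b : m) := CStarMatrix.star_columnAt_mul_columnAt_apply p S i j a b
  have hs (i : m) : CStarMatrix.columnAt p S i * star (CStarMatrix.columnAt p S i) *
      CStarMatrix.columnAt p S i = CStarMatrix.columnAt p S i := by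
    rw [mul_assoc]
    ext a b
    rw [CStarMatrix.mul_apply]
    simp only [hmul, hdiag, CStarMatrix.columnAt_apply]
    by_cases hb : b = p <;> simp [hb]
  refine ⟨fun i => ⟨halmosMatrix (CStarMatrix.columnAt p S i), halmosMatrix_mem_unitary (hs i)⟩,
    fun i j => ?_⟩
  rw [star_halmosMatrix_mul_halmosMatrix_apply_zero, CStarMatrix.add_apply,
    CStarMatrix.mul_apply (M := 1 - _)]
  simp only [CStarMatrix.sub_apply, hmul, hdiag, CStarMatrix.one_apply]
  simp

/-! ### Unital completely positive maps on `W_n` -/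

theorem freeUnitary_mem_unitary (n : ℕ) (i : Fin (n + 1)) : freeUnitary n i ∈ unitary _ := by
  induction i using Fin.lastCases with
  | last => simp [freeUnitary]
  | cast i =>
    rw [freeUnitary, Fin.lastCases_castSucc]
    exact FullGroupCStarAlgebra.of_mem_unitary _

theorem star_freeUnitary_mul_freeUnitary_mem (n : ℕ) (i j : Fin (n + 1)) :
    star (freeUnitary n i) * freeUnitary n j ∈ (freeOperatorSystem n).toSubmodule :=
  Submodule.subset_span ⟨(i, j), rfl⟩

/-- The element `u_i^* u_j` of `W_n`. -/
def freeGenerator (n : ℕ) (i j : Fin (n + 1)) : (freeOperatorSystem n).toSubmodule :=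
  ⟨star (freeUnitary n i) * freeUnitary n j, star_freeUnitary_mul_freeUnitary_mem n i j⟩

variable {A : Type v} [CStarAlgebra A] [PartialOrder A] [StarOrderedRing A]

/-- Positive matrices with unit diagonal parametrize u.c.p. maps on `W_n`. The map is defined as the
restriction of a compressed `*`-homomorphism on `C*(F_n)`, so that linear relations between the
`u_i^* u_j` need no attention. -/
theorem exists_isUCP_of_nonneg {n : ℕ} {P : CStarMatrix (Fin (n + 1)) (Fin (n + 1)) A}
    (hP : 0 ≤ P) (hdiag : ∀ i, P i i = 1) :
    ∃ ψ : (freeOperatorSystem n).toSubmodule →ₗ[ℂ] A,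
      OperatorSystem.IsUCP ψ ∧ ∀ i j, ψ (freeGenerator n i j) = P i j := by
  obtain ⟨U, hU⟩ := exists_unitary_dilation (Fin.last n) hP hdiag
  obtain ⟨π, hπ⟩ := FullGroupCStarAlgebra.exists_starAlgHom
    (FreeGroup.lift fun i : Fin n => star (U (Fin.last n)) * U i.castSucc)
  have hπu (i : Fin (n + 1)) :
      π (freeUnitary n i) = (star (U (Fin.last n)) * U i : unitary _) := by
    induction i using Fin.lastCases with
    | last => simp [freeUnitary]
    | cast i => rw [freeUnitary, Fin.lastCases_castSucc, hπ, FreeGroup.lift_apply_of]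
  let corner : CStarMatrix (Fin 2) (Fin 2) (CStarMatrix (Fin (n + 1)) (Fin (n + 1)) A) →ₗ[ℂ] A :=
    { toFun d := d 0 0 (Fin.last n) (Fin.last n)
      map_add' _ _ := rfl
      map_smul' _ _ := rfl }
  let ψ : (freeOperatorSystem n).toSubmodule →ₗ[ℂ] A :=
    (corner ∘ₗ (π : _ →ₗ[ℂ] _)) ∘ₗ (freeOperatorSystem n).toSubmodule.subtype
  have hψ (x) : ψ x = (π x) 0 0 (Fin.last n) (Fin.last n) := rfl
  refine ⟨ψ, ⟨?_, fun k M hM => ?_⟩, fun i j => ?_⟩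
  · rw [OperatorSystem.IsUnital, hψ, map_one, CStarMatrix.one_apply_eq, CStarMatrix.one_apply_eq]
  · exact CStarMatrix.nonneg_map_diagEntry _ (CStarMatrix.nonneg_map_diagEntry _
      (CompletelyPositiveMapClass.map_cstarMatrix_nonneg' π k _ hM))
  · have h : π (freeGenerator n i j : FullGroupCStarAlgebra (FreeGroup (Fin n))) =
        star (U i : CStarMatrix (Fin 2) (Fin 2) (CStarMatrix (Fin (n + 1)) (Fin (n + 1)) A)) *
          U j := by
      rw [freeGenerator, map_mul, map_star, hπu, hπu, ← Unitary.coe_star, ← Submonoid.coe_mul,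
        star_mul, star_star, mul_assoc, ← mul_assoc (U (Fin.last n)), Unitary.mul_star_self,
        one_mul]
      rfl
    rw [hψ, h, hU]

/-! ### Almost positive elements of a C*-algebra -/

section NearPositive

variable {C : Type*} [CStarAlgebra C]

/-- In contrast to `norm_one`, this includes the zero algebra. -/
theorem CStarAlgebra.norm_one_le : ‖(1 : C)‖ ≤ 1 := by
  obtain _ | _ := subsingleton_or_nontrivial C
  · simp [Subsingleton.elim (1 : C) 0]
  · exact CStarRing.norm_one.le

theorem norm_add_I_smul_one_le {V : C} (hsa : IsSelfAdjoint V) (hV : V * V = 1) (t : ℝ) :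
    ‖V + (Complex.I * t) • (1 : C)‖ ≤ √(1 + t ^ 2) := by
  have h : star (V + (Complex.I * t) • (1 : C)) * (V + (Complex.I * t) • (1 : C)) =
      ((1 + t ^ 2 : ℝ) : ℂ) • (1 : C) := by
    simp only [star_add, star_smul, hsa.star_eq, star_one, mul_add, add_mul, hV, smul_mul_assoc,
      mul_smul_comm, one_mul, mul_one, Complex.star_def, map_mul, Complex.conj_I,
      Complex.conj_ofReal]
    match_scalars
    · simp
      ring_nf
      simp
    · simp
  refine Real.le_sqrt_of_sq_le ?_
  rw [sq, ← CStarRing.norm_star_mul_self, h, norm_smul, Complex.norm_real, Real.norm_eq_abs,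
    abs_of_nonneg (by positivity)]
  exact mul_le_of_le_one_right (by positivity) CStarAlgebra.norm_one_le

variable [PartialOrder C] [StarOrderedRing C]

theorem IsSelfAdjoint.norm_le_of_le {b : C} (hb : IsSelfAdjoint b) {r : ℝ} (hr : 0 ≤ r)
    (h1 : b ≤ algebraMap ℝ C r) (h2 : -b ≤ algebraMap ℝ C r) : ‖b‖ ≤ r := by
  obtain _ | _ := subsingleton_or_nontrivial C
  · simpa [Subsingleton.elim b 0] using hr
  rcases CStarAlgebra.norm_or_neg_norm_mem_spectrum hb with h | h
  · exact (le_algebraMap_iff_spectrum_le hb).mp h1 _ h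
  · refine (le_algebraMap_iff_spectrum_le hb.neg).mp h2 _ ?_
    rw [← spectrum.neg_eq]
    simpa using h

/-- Expand `(Y + i t)^* (Y + i t) = Y^* Y + 2 t ℑ Y + t²` and discard `Y^* Y ≥ 0`. -/
theorem smul_imaginaryPart_le {Y : C} {r t : ℝ} (h : ‖Y + (Complex.I * t) • (1 : C)‖ ≤ r) :
    (2 * t) • (imaginaryPart Y : C) ≤ algebraMap ℝ C (r ^ 2 - t ^ 2) := by
  have h1 : star (Y + (Complex.I * t) • (1 : C)) * (Y + (Complex.I * t) • (1 : C)) =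
      star Y * Y + (2 * t) • (imaginaryPart Y : C) + algebraMap ℝ C (t ^ 2) := by
    rw [imaginaryPart_apply_coe, Algebra.algebraMap_eq_smul_one]
    simp only [star_add, star_smul, star_one, mul_add, add_mul, smul_mul_assoc,
      mul_smul_comm, one_mul, mul_one, smul_smul, Complex.star_def, map_mul, Complex.conj_I,
      Complex.conj_ofReal, ← Complex.coe_smul, smul_sub]
    match_scalars <;> simp
    · ring
    · ring
    · linear_combination (-(t : ℂ) ^ 2) * Complex.I_sq
  have h2 := (CStarAlgebra.star_mul_le_algebraMap_norm_sq
    (a := Y + (Complex.I * t) • (1 : C))).trans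
      (algebraMap_mono C (pow_le_pow_left₀ (norm_nonneg _) h 2))
  rw [h1, add_assoc] at h2
  rw [map_sub, le_sub_iff_add_le]
  exact (le_add_of_nonneg_left (star_mul_self_nonneg Y)).trans h2

/-- An element whose imaginary translates have almost the norm that a self-adjoint contraction
permits has small imaginary part. -/
theorem norm_imaginaryPart_le {Y : C} {s : ℝ} (hs : 0 < s) (hs1 : s ≤ 1)
    (h : ∀ t : ℝ, ‖Y + (Complex.I * t) • (1 : C)‖ ≤ (1 + s ^ 2) * √(1 + t ^ 2)) :
    ‖(imaginaryPart Y : C)‖ ≤ 4 * s := by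
  -- `t = ±1/s` balances the two terms of the bound `((1 + s²)² (1 + t²) - t²) / (2t)` for `±ℑ Y`
  have key (t : ℝ) (ht : t ^ 2 * s ^ 2 = 1) : ((1 + s ^ 2) * √(1 + t ^ 2)) ^ 2 - t ^ 2 ≤ 8 := by
    rw [mul_pow, Real.sq_sqrt (by positivity)]
    nlinarith [sq_nonneg s, pow_le_one₀ hs.le hs1 (n := 2)]
  have hc : (s / 2) * 8 = 4 * s := by ring
  refine (imaginaryPart Y).2.norm_le_of_le (by positivity) ?_ ?_
  · have h1 := (smul_imaginaryPart_le (h s⁻¹)).trans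
      (algebraMap_mono C (key s⁻¹ (by field_simp)))
    have h2 := smul_le_smul_of_nonneg_left h1 (by positivity : 0 ≤ s / 2)
    rw [smul_smul, Algebra.algebraMap_eq_smul_one, smul_smul, hc,
      (by field_simp : s / 2 * (2 * s⁻¹) = 1), one_smul, ← Algebra.algebraMap_eq_smul_one] at h2
    exact h2
  · have h1 := (smul_imaginaryPart_le (h (-s⁻¹))).trans
      (algebraMap_mono C (key (-s⁻¹) (by field_simp)))
    have h2 := smul_le_smul_of_nonneg_left h1 (by positivity : 0 ≤ s / 2)
    rw [smul_smul, Algebra.algebraMap_eq_smul_one, smul_smul, hc,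
      (by field_simp : s / 2 * (2 * -s⁻¹) = -1), neg_one_smul,
      ← Algebra.algebraMap_eq_smul_one] at h2
    exact h2

/-- If `(2 / N) Q - 1` is almost a self-adjoint contraction, in the sense of the norms of its
imaginary translates, then `Q` is close to a positive element. That element is the convex
combination `(ℜ Q + c) / (1 + c)` of `ℜ Q` and `1`, which has unit diagonal whenever `Q` is a matrix
with unit diagonal. -/
theorem nonneg_and_norm_sub_le {Q : C} {N s : ℝ} (hN : 1 ≤ N) (hs : 0 < s) (hs1 : s ≤ 1)
    (h : ∀ t : ℝ, ‖((2 / N : ℝ) : ℂ) • Q + (Complex.I * t - 1) • (1 : C)‖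
      ≤ (1 + s ^ 2) * √(1 + t ^ 2)) :
    0 ≤ (1 + N * s ^ 2 / 2)⁻¹ • ((realPart Q : C) + (N * s ^ 2 / 2) • (1 : C)) ∧
      ‖(1 + N * s ^ 2 / 2)⁻¹ • ((realPart Q : C) + (N * s ^ 2 / 2) • (1 : C)) - Q‖
        ≤ 4 * N ^ 2 * s := by
  have hN0 : 0 < N := by linarith
  set c : ℝ := N * s ^ 2 / 2 with hc
  have hc0 : 0 < c := by positivity
  -- `Y` is kept opaque, so that `Q` can be rewritten in terms of it
  obtain ⟨Y, hY⟩ : ∃ Y, Y = (2 / N) • Q - (1 : C) := ⟨_, rfl⟩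
  have hQ : Q = (N / 2) • Y + (N / 2) • (1 : C) := by
    rw [hY]
    match_scalars <;> field_simp
    ring
  have hYt (t : ℝ) : ‖Y + (Complex.I * t) • (1 : C)‖ ≤ (1 + s ^ 2) * √(1 + t ^ 2) := by
    refine le_of_eq_of_le (congrArg _ ?_) (h t)
    rw [hY, Complex.coe_smul, sub_smul, one_smul]
    abel
  have hY0 : ‖Y‖ ≤ 1 + s ^ 2 := by simpa using hYt 0
  have hre : (realPart Q : C) = (N / 2) • (realPart Y : C) + (N / 2) • (1 : C) := by
    conv_lhs => rw [hQ]
    rw [realPart_apply_coe, realPart_apply_coe]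
    simp only [star_add, star_smul, star_one, star_trivial]
    match_scalars <;> ring
  have hreY : ‖(realPart Y : C)‖ ≤ 1 + s ^ 2 := (realPart.norm_le Y).trans hY0
  have him := norm_imaginaryPart_le hs hs1 hYt
  have hdec := realPart_add_I_smul_imaginaryPart Y
  constructor
  · refine smul_nonneg (by positivity) ?_
    have h1 : -(realPart Y : C) ≤ algebraMap ℝ C (1 + s ^ 2) :=
      (IsSelfAdjoint.le_algebraMap_norm_self (realPart Y).2.neg).trans
        (algebraMap_mono C (by rwa [norm_neg]))
    have h2 : 0 ≤ (realPart Y : C) + (1 + s ^ 2) • (1 : C) := by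
      rwa [← Algebra.algebraMap_eq_smul_one, add_comm, ← neg_le_iff_add_nonneg', neg_le]
    have h3 := smul_nonneg (by positivity : 0 ≤ N / 2) h2
    refine le_of_le_of_eq h3 ?_
    rw [hre, hc]
    match_scalars <;> ring
  · have e : (1 + c)⁻¹ • ((realPart Q : C) + c • (1 : C)) - Q =
        (c * (1 + c)⁻¹) • ((1 : C) - (realPart Q : C)) -
          (N / 2) • Complex.I • (imaginaryPart Y : C) := by
      have hQ' : Q = (N / 2) • ((realPart Y : C) + Complex.I • (imaginaryPart Y : C)) +
          (N / 2) • (1 : C) := by rw [hdec]; exact hQ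
      rw [hre, hQ']
      -- with `i ℑ Y` as an atom all scalars are real
      generalize Complex.I • (imaginaryPart Y : C) = J
      match_scalars
      · field_simp
        ring
      · field_simp
        ring
      · ring
    have hreQ : ‖(1 : C) - (realPart Q : C)‖ ≤ 3 * N := by
      have h1 : ‖(realPart Q : C)‖ ≤ N / 2 * (1 + s ^ 2) + N / 2 * 1 := by
        rw [hre]
        refine (norm_add_le _ _).trans (add_le_add ?_ ?_) <;>
          rw [norm_smul, Real.norm_of_nonneg (by positivity)] <;> gcongr
        exact CStarAlgebra.norm_one_le
      have h2 := CStarAlgebra.norm_one_le (C := C)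
      have h3 := norm_sub_le (1 : C) (realPart Q : C)
      nlinarith [pow_le_one₀ hs.le hs1 (n := 2)]
    rw [e]
    have h4 : c * (1 + c)⁻¹ ≤ c :=
      mul_le_of_le_one_right hc0.le (inv_le_one_of_one_le₀ (by linarith))
    have h5 : ‖(c * (1 + c)⁻¹) • ((1 : C) - (realPart Q : C))‖ ≤ c * (3 * N) := by
      rw [norm_smul, Real.norm_of_nonneg (by positivity)]
      gcongr
    have h6 : ‖(N / 2) • Complex.I • (imaginaryPart Y : C)‖ ≤ N / 2 * (4 * s) := by
      rw [norm_smul, norm_smul, Complex.norm_I, one_mul, Real.norm_of_nonneg (by positivity)]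
      gcongr
    refine (norm_sub_le _ _).trans ((add_le_add h5 h6).trans ?_)
    rw [hc]
    have h7 : s ^ 2 ≤ s := by nlinarith
    have h8 : N ≤ N ^ 2 := by nlinarith
    nlinarith [mul_le_mul_of_nonneg_left h7 (sq_nonneg N), mul_le_mul_of_nonneg_right h8 hs.le]

end NearPositive

/-! ### Almost contractive maps on `W_n` -/

theorem star_freeUnitary_mul_self (n : ℕ) (i : Fin (n + 1)) :
    star (freeUnitary n i) * freeUnitary n i = 1 :=
  (Unitary.mem_iff.mp (freeUnitary_mem_unitary n i)).1

theorem freeUnitary_mul_star_self (n : ℕ) (i : Fin (n + 1)) :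
    freeUnitary n i * star (freeUnitary n i) = 1 :=
  (Unitary.mem_iff.mp (freeUnitary_mem_unitary n i)).2

/-- The Gram matrix `[u_i^* u_j]`, which is `n + 1` times a projection. -/
def freeGram (n : ℕ) :
    CStarMatrix (Fin (n + 1)) (Fin (n + 1)) (FullGroupCStarAlgebra (FreeGroup (Fin n))) :=
  CStarMatrix.ofMatrix fun i j => star (freeUnitary n i) * freeUnitary n j

theorem freeGram_apply (n : ℕ) (i j : Fin (n + 1)) :
    freeGram n i j = star (freeUnitary n i) * freeUnitary n j := rfl

theorem isSelfAdjoint_freeGram (n : ℕ) : IsSelfAdjoint (freeGram n) := by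
  ext i j
  simp [CStarMatrix.star_apply, freeGram_apply]

theorem freeGram_mul_self (n : ℕ) : freeGram n * freeGram n = ((n + 1 : ℝ) : ℂ) • freeGram n := by
  ext i j
  have h (k : Fin (n + 1)) : freeGram n i k * freeGram n k j = freeGram n i j := by
    rw [freeGram_apply, freeGram_apply, mul_assoc, ← mul_assoc (freeUnitary n k),
      freeUnitary_mul_star_self, one_mul]
    rfl
  rw [CStarMatrix.mul_apply, CStarMatrix.smul_apply]
  simp_rw [h, Finset.sum_const, Finset.card_univ, Fintype.card_fin]
  rw [← Nat.cast_smul_eq_nsmul ℂ]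
  push_cast
  rfl

theorem norm_freeGram_add_le (n : ℕ) (t : ℝ) :
    ‖((2 / (n + 1) : ℝ) : ℂ) • freeGram n + (Complex.I * t - 1) • 1‖ ≤ √(1 + t ^ 2) := by
  have hn : ((n + 1 : ℝ) : ℂ) ≠ 0 := by exact_mod_cast (by positivity : (n + 1 : ℝ) ≠ 0)
  have h := norm_add_I_smul_one_le (V := ((2 / (n + 1) : ℝ) : ℂ) • freeGram n - 1) ?_ ?_ t
  · refine le_of_eq_of_le (congrArg _ ?_) h
    rw [sub_smul, one_smul]
    abel
  · refine IsSelfAdjoint.sub ?_ (.one _)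
    rw [Complex.coe_smul]
    exact (IsSelfAdjoint.all _).smul (isSelfAdjoint_freeGram n)
  · simp only [sub_mul, mul_sub, smul_mul_smul_comm, freeGram_mul_self, one_mul, mul_one,
      smul_smul]
    match_scalars
    · push_cast at hn ⊢
      field_simp
      ring
    · norm_num

variable {A : Type v} [CStarAlgebra A] [PartialOrder A] [StarOrderedRing A]

theorem OperatorSystem.norm_map_le_of_matrixENorm_lt {B : Type u} [CStarAlgebra B] [PartialOrder B]
    [StarOrderedRing B] {X : OperatorSystem B} {k : ℕ} {φ : X.toSubmodule →ₗ[ℂ] A} {K : ℝ}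
    (hφ : matrixENorm k φ < ENNReal.ofReal K)
    (M : CStarMatrix (Fin k) (Fin k) X.toSubmodule) {r : ℝ} (hr : 0 < r)
    (hM : ‖(M.map (fun x => (x : B)) : CStarMatrix (Fin k) (Fin k) B)‖ ≤ r) :
    ‖(M.map φ : CStarMatrix (Fin k) (Fin k) A)‖ ≤ K * r := by
  have hcoe : (((r⁻¹ : ℝ) : ℂ) • M).map (fun x => (x : B)) =
      ((r⁻¹ : ℝ) : ℂ) • (M.map (fun x => (x : B)) : CStarMatrix (Fin k) (Fin k) B) := rfl
  have hmap : (((r⁻¹ : ℝ) : ℂ) • M).map φ =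
      ((r⁻¹ : ℝ) : ℂ) • (M.map φ : CStarMatrix (Fin k) (Fin k) A) := by
    ext i j
    exact map_smul φ _ _
  have hK : 0 < K := ENNReal.ofReal_pos.mp (bot_le.trans_lt hφ)
  have hle : ENNReal.ofReal ‖((r⁻¹ : ℝ) : ℂ) • (M.map φ : CStarMatrix (Fin k) (Fin k) A)‖ ≤
      matrixENorm k φ := by
    rw [← hmap]
    refine le_iSup₂_of_le (((r⁻¹ : ℝ) : ℂ) • M) ?_ le_rfl
    rw [hcoe, norm_smul, Complex.norm_real, Real.norm_of_nonneg (by positivity)]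
    exact (inv_mul_le_one₀ hr).mpr hM
  have h := (ENNReal.ofReal_le_ofReal_iff hK.le).mp (hle.trans hφ.le)
  rw [norm_smul, Complex.norm_real, Real.norm_of_nonneg (by positivity), inv_mul_le_iff₀ hr] at h
  linarith

instance (n : ℕ) : FiniteDimensional ℂ (freeOperatorSystem n).toSubmodule :=
  FiniteDimensional.span_of_finite ℂ (Set.finite_range _)

/-- A linear map on `W_n` that is small on the `u_i^* u_j` has small norm, with a constant that
depends only on `n` and not on the target. -/
theorem exists_norm_le_of_forall_generator (n : ℕ) : ∃ C : ℝ, 0 < C ∧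
    ∀ (A : Type v) [CStarAlgebra A] (θ : (freeOperatorSystem n).toSubmodule →ₗ[ℂ] A) (η : ℝ),
      (∀ i j, ‖θ (freeGenerator n i j)‖ ≤ η) → ∀ x, ‖θ x‖ ≤ C * η * ‖x‖ := by
  -- a linear section `R` of `ℂ^{(n+1)²} → W_n` picks coefficients bounded by `‖R‖ ‖x‖`
  let T : (Fin (n + 1) × Fin (n + 1) → ℂ) →ₗ[ℂ] (freeOperatorSystem n).toSubmodule :=
    Fintype.linearCombination ℂ fun ij => freeGenerator n ij.1 ij.2
  have hT : LinearMap.range T = ⊤ := by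
    have hspan : Submodule.map (freeOperatorSystem n).toSubmodule.subtype (LinearMap.range T) =
        (freeOperatorSystem n).toSubmodule := by
      rw [Fintype.range_linearCombination, Submodule.map_span, ← Set.range_comp]
      rfl
    refine Submodule.map_injective_of_injective (Submodule.subtype_injective _) ?_
    rw [hspan, Submodule.map_top, Submodule.range_subtype]
  obtain ⟨R, hR⟩ := T.exists_rightInverse_of_surjective hT
  refine ⟨((n + 1) * (n + 1)) * (‖R.toContinuousLinearMap‖ + 1), by positivity,
    fun A _ θ η hθ x => ?_⟩
  have hη : 0 ≤ η := (norm_nonneg _).trans (hθ 0 0)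
  have hx : T (R x) = x := LinearMap.congr_fun hR x
  have hRx (ij) : ‖R x ij‖ ≤ (‖R.toContinuousLinearMap‖ + 1) * ‖x‖ :=
    (norm_le_pi_norm (R x) ij).trans ((R.toContinuousLinearMap.le_opNorm x).trans
      (mul_le_mul_of_nonneg_right (by linarith) (norm_nonneg x)))
  conv_lhs => rw [← hx]
  rw [Fintype.linearCombination_apply, map_sum]
  refine (norm_sum_le _ _).trans ((Finset.sum_le_card_nsmul _ _
    ((‖R.toContinuousLinearMap‖ + 1) * ‖x‖ * η) fun ij _ => ?_).trans (le_of_eq ?_))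
  · rw [map_smul, norm_smul]
    exact mul_le_mul (hRx ij) (hθ _ _) (norm_nonneg _) (by positivity)
  · simp
    ring

/-- A unital map with `‖φ‖_{n+1} < 1 + s²` is within `O(s)` of a u.c.p. map on
the generators `u_i^* u_j`. -/
theorem exists_isUCP_near (n : ℕ) {s : ℝ} (hs : 0 < s) (hs1 : s ≤ 1)
    (φ : (freeOperatorSystem n).toSubmodule →ₗ[ℂ] A) (h1 : OperatorSystem.IsUnital φ)
    (hφ : OperatorSystem.matrixENorm (n + 1) φ < ENNReal.ofReal (1 + s ^ 2)) :
    ∃ ψ : (freeOperatorSystem n).toSubmodule →ₗ[ℂ] A, OperatorSystem.IsUCP ψ ∧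
      ∀ i j, ‖(ψ - φ) (freeGenerator n i j)‖ ≤ 4 * (n + 1) ^ 2 * s := by
  -- `one` is the unit matrix over `W_n`, which carries no `One` instance
  let G : CStarMatrix (Fin (n + 1)) (Fin (n + 1)) (freeOperatorSystem n).toSubmodule :=
    CStarMatrix.ofMatrix (freeGenerator n)
  let one : CStarMatrix (Fin (n + 1)) (Fin (n + 1)) (freeOperatorSystem n).toSubmodule :=
    CStarMatrix.ofMatrix fun i j => if i = j then ⟨1, (freeOperatorSystem n).one_mem'⟩ else 0
  let Q : CStarMatrix (Fin (n + 1)) (Fin (n + 1)) A := G.map φ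
  have hQ (i j) : Q i j = φ (freeGenerator n i j) := rfl
  have hQdiag (i) : Q i i = 1 := by
    rw [hQ, ← h1]
    congr 1
    exact Subtype.ext (star_freeUnitary_mul_self n i)
  have hcoe (α β : ℂ) : (α • G + β • one).map (fun x => x.1) = α • freeGram n + β • 1 := by
    ext i j
    change α • (freeGram n i j) + β • (one i j).1 = α • (freeGram n i j) + β • _
    rw [CStarMatrix.one_apply]
    change _ + β • (if i = j then _ else _ : (freeOperatorSystem n).toSubmodule).1 = _
    split_ifs <;> rfl
  have hmap (α β : ℂ) : (α • G + β • one).map φ = α • Q + β • 1 := by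
    ext i j
    change φ (α • G i j + β • one i j) = α • φ (G i j) + β • _
    rw [map_add, map_smul, map_smul, CStarMatrix.one_apply]
    change _ + β • φ (if i = j then _ else _) = _
    split_ifs
    · rw [h1]
    · rw [map_zero]
  obtain ⟨hP0, hPQ⟩ := nonneg_and_norm_sub_le (Q := Q) (N := n + 1) (by simp) hs hs1 fun t => by
    rw [← hmap]
    refine OperatorSystem.norm_map_le_of_matrixENorm_lt hφ _ (by positivity) ?_
    rw [hcoe]
    exact norm_freeGram_add_le n t
  obtain ⟨ψ, hψ, hψP⟩ := exists_isUCP_of_nonneg hP0 fun i => by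
    rw [realPart_apply_coe]
    change (_ : ℝ) • ((_ : ℝ) • (Q i i + star (Q i i)) + (_ : ℝ) • (1 : CStarMatrix _ _ A) i i) = 1
    rw [hQdiag, CStarMatrix.one_apply_eq, star_one]
    match_scalars
    field_simp
    ring
  refine ⟨ψ, hψ, fun i j => ?_⟩
  rw [LinearMap.sub_apply, hψP, ← hQ]
  exact (CStarMatrix.norm_entry_le_norm (M := _ - Q) (i := i) (j := j)).trans hPQ

theorem OperatorSystem.IsUCP.comp_inclusion {B : Type u} [CStarAlgebra B] [PartialOrder B]
    [StarOrderedRing B] {E X : OperatorSystem B} (h : E.toSubmodule ≤ X.toSubmodule)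
    {ψ : X.toSubmodule →ₗ[ℂ] A} (hψ : IsUCP ψ) : IsUCP (ψ ∘ₗ Submodule.inclusion h) :=
  ⟨hψ.1, fun k M hM => hψ.2 k (M.map (Submodule.inclusion h)) hM⟩

/-! ### CP-stability -/

theorem opENorm_lt_of_norm_le {E : Type u} {F : Type v} [NormedAddCommGroup E] [NormedSpace ℂ E]
    [NormedAddCommGroup F] [NormedSpace ℂ F] {f : E →ₗ[ℂ] F} {r δ : ℝ} (hr : 0 ≤ r) (hδ : r < δ)
    (h : ∀ x, ‖f x‖ ≤ r * ‖x‖) : opENorm f < ENNReal.ofReal δ := by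
  refine (iSup₂_le fun x hx => ENNReal.ofReal_le_ofReal ?_).trans_lt
    ((ENNReal.ofReal_lt_ofReal_iff_of_nonneg hr).mpr hδ)
  exact (h x).trans (mul_le_of_le_one_right hr hx)

theorem exists_forall_exists_isUCP_norm_sub_le (n : ℕ) {r : ℝ} (hr : 0 < r) :
    ∃ ε : ℝ, 0 < ε ∧
      ∀ (A : Type v) [CStarAlgebra A] [PartialOrder A] [StarOrderedRing A]
        (φ : (freeOperatorSystem n).toSubmodule →ₗ[ℂ] A), OperatorSystem.IsUnital φ →
        OperatorSystem.matrixENorm (n + 1) φ < ENNReal.ofReal (1 + ε) →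
          ∃ ψ : (freeOperatorSystem n).toSubmodule →ₗ[ℂ] A,
            OperatorSystem.IsUCP ψ ∧ ∀ x, ‖(ψ - φ) x‖ ≤ r * ‖x‖ := by
  obtain ⟨C, hC, hbound⟩ := exists_norm_le_of_forall_generator.{v} n
  set s : ℝ := min 1 (r / (C * (4 * (n + 1) ^ 2))) with hs
  have hs0 : 0 < s := lt_min one_pos (by positivity)
  refine ⟨s ^ 2, by positivity, fun A _ _ _ φ h1 hφ => ?_⟩
  obtain ⟨ψ, hψ, hnear⟩ := exists_isUCP_near n hs0 (min_le_left _ _) φ h1 hφ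
  refine ⟨ψ, hψ, fun x => (hbound A (ψ - φ) _ hnear x).trans ?_⟩
  gcongr
  rw [← mul_assoc, mul_comm]
  exact (le_div_iff₀ (by positivity)).mp (min_le_right _ _)

end

theorem theorem1 (n : ℕ) :
    OperatorSystem.CPStable.{0, v} (freeOperatorSystem n) ∧
      ∀ δ : ℝ, 0 < δ → ∃ ε : ℝ, 0 < ε ∧
        ∀ (A : Type v) [CStarAlgebra A] [PartialOrder A] [StarOrderedRing A]
          (φ : (freeOperatorSystem n).toSubmodule →ₗ[ℂ] A),
          OperatorSystem.IsUnital φ →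
          OperatorSystem.matrixENorm (n + 1) φ < ENNReal.ofReal (1 + ε) →
            ∃ ψ : (freeOperatorSystem n).toSubmodule →ₗ[ℂ] A,
              OperatorSystem.IsUCP ψ ∧ opENorm (ψ - φ) < ENNReal.ofReal δ := by
  refine ⟨fun E hE _ δ hδ => ?_, fun δ hδ => ?_⟩
  · obtain ⟨ε, hε, h⟩ := exists_forall_exists_isUCP_norm_sub_le.{v} n (half_pos hδ)
    refine ⟨freeOperatorSystem n, hE, le_rfl, inferInstance, n + 1, ε, n.succ_pos, hε,
      fun A _ _ _ φ h1 hφ => ?_⟩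
    obtain ⟨ψ, hψ, hnear⟩ := h A φ h1 hφ
    refine ⟨ψ ∘ₗ Submodule.inclusion hE, hψ.comp_inclusion hE,
      opENorm_lt_of_norm_le (half_pos hδ).le (half_lt_self hδ) fun x => ?_⟩
    have := hnear (Submodule.inclusion hE x)
    rw [LinearMap.sub_apply, norm_sub_rev] at this
    exact this
  · obtain ⟨ε, hε, h⟩ := exists_forall_exists_isUCP_norm_sub_le.{v} n (half_pos hδ)
    refine ⟨ε, hε, fun A _ _ _ φ h1 hφ => ?_⟩
    obtain ⟨ψ, hψ, hnear⟩ := h A φ h1 hφ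
    exact ⟨ψ, hψ, opENorm_lt_of_norm_le (half_pos hδ).le (half_lt_self hδ) hnear⟩
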